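/- Let $k$ be a field and let $\mathcal C$ be a $k$-linear category whose objects are parametrized by the nonnegative integers, such that every $\mathcal C(r,s)$ is finite dimensional over $k$ and $\mathcal C(r,s)=0$ whenever $r>s$. A $\mathcal C$-module is a $k$-linear functor $V$ from $\mathcal C$ to $k$-modules; write $V_s=V(s)$ and $M(s)=\mathcal C(s,-)$. A $\mathcal C$-module $V$ is finitely generated if some finite set of elements of $V$ lies in no proper submodule of $V$, and finitely presented if there is an exact sequence $P_1\to P_0\to V\to 0$ with $P_0,P_1$ finitely generated projective $\mathcal C$-modules. For an integer $d\ge -1$, $V$ is generated in degrees $\le d$ if the only submodule of $V$ containing $V_r$ for all $0\le r\le d$ is $V$ (so $d=-1$ means $V=0$); the generating degree $\mathrm{gd}(V)\in\{-1,0,1,\dots\}\cup\{\infty\}$ is the least such $d$, or $\infty$ if there is none. Let $\iota:\mathcal C\to\mathcal C$ be a faithful $k$-linear functor with $\iota(s)=s+1$ for all $s\ge 0$, and let $S=\iota^*$, $V\mapsto V\circ\iota$, be the induced endofunctor of the category of $\mathcal C$-modules. Suppose that $S$ is a generic shift functor, that is, there is a natural transformation $\mu:\mathrm{Id}\to S$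 such that for every $s\ge 0$ the map $\mu_{M(s)}:M(s)\to SM(s)$ is injective with cokernel generated in degrees $\le s-1$. Suppose moreover that $SM(s)$ is finitely presented for every $s\ge 0$. Then for every finitely generated $\mathcal C$-module $V$, every $V_n$ is finite dimensional over $k$, and there is a polynomial $Q\in\mathbb Q[t]$, either zero or of degree at most $\mathrm{gd}(V)$, such that $\dim_k V_n=Q(n)$ for all sufficiently large $n$. -/

import Mathlib

open CategoryTheory

universe u v w

namespace GenericShift

/-- The standing conditions on a `k`-linear category `C` whose objects are parameterized
(through the bijection `ob`) by the nonnegative integers. -/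
structure IsLocallyFiniteDirected (k : Type u) [CommRing k] {C : Type w} [Category.{v} C]
    [Preadditive C] [Linear k C] (ob : ℕ ≃ C) : Prop where
  locallyFinite : ∀ r s : ℕ, Module.Finite k (ob r ⟶ ob s)
  directed : ∀ r s : ℕ, s < r → ∀ f : ob r ⟶ ob s, f = 0

/-- A functor from `C` to `k`-modules is a representation of `C` if it is `k`-linear. -/
def isRep (k : Type u) [CommRing k] (C : Type w) [Category.{v} C]
    [Preadditive C] [Linear k C] : ObjectProperty (C ⥤ ModuleCat.{v} k) :=
  fun F => ∃ _ : F.Additive, F.Linear k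

/-- The category of `C`-modules: `k`-linear functors from `C` to `k`-modules and all natural
transformations between them. -/
abbrev Rep (k : Type u) [CommRing k] (C : Type w) [Category.{v} C]
    [Preadditive C] [Linear k C] : Type (max u v w (v + 1)) :=
  (isRep k C).FullSubcategory

section

variable {k : Type u} [CommRing k] {C : Type w} [Category.{v} C] [Preadditive C] [Linear k C]

/-- The linear map `V(x) → V(y)` by which a morphism `f : x ⟶ y` of `C` acts on `V`. -/
abbrev Rep.act (V : Rep k C) {x y : C} (f : x ⟶ y) : V.obj.obj x →ₗ[k] V.obj.obj y :=
  (V.obj.map f).hom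

/-- The component at `x` of a homomorphism of `C`-modules. -/
abbrev Rep.comp {V W : Rep k C} (φ : V ⟶ W) (x : C) : V.obj.obj x →ₗ[k] W.obj.obj x :=
  (φ.hom.app x).hom

/-- A `C`-submodule of `V`. -/
structure SubRep (V : Rep k C) where
  carrier : ∀ x : C, Submodule k (V.obj.obj x)
  act_mem : ∀ {x y : C} (f : x ⟶ y) {v : V.obj.obj x}, v ∈ carrier x → V.act f v ∈ carrier y

/-- `V` contains a finite set (of homogeneous elements) such that the only submodule of `V`
containing it is `V`. -/
def FinitelyGenerated (V : Rep k C) : Prop :=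
  ∃ X : Set (Σ x : C, V.obj.obj x), X.Finite ∧
    ∀ U : SubRep V, (∀ p ∈ X, p.2 ∈ U.carrier p.1) → ∀ x, U.carrier x = ⊤

/-- There is an exact sequence `P₁ → P₀ → V → 0` with `P₁` and `P₀` finitely generated projective
`C`-modules. -/
def FinitelyPresented (V : Rep k C) : Prop :=
  ∃ (P₁ P₀ : Rep k C) (d : P₁ ⟶ P₀) (π : P₀ ⟶ V),
    Projective P₁ ∧ Projective P₀ ∧ FinitelyGenerated P₁ ∧ FinitelyGenerated P₀ ∧
    (∀ x, Function.Surjective (Rep.comp π x)) ∧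
    ∀ x, Function.Exact (Rep.comp d x) (Rep.comp π x)

/-- `V` is generated in degrees `≤ d`: the only submodule of `V` containing `V_r` for all `r ≤ d`
is `V`. For `d = -1` this says `V = 0`. -/
def GeneratedInDegreesLE (ob : ℕ ≃ C) (V : Rep k C) (d : ℤ) : Prop :=
  ∀ U : SubRep V, (∀ r : ℕ, (r : ℤ) ≤ d → U.carrier (ob r) = ⊤) → ∀ x, U.carrier x = ⊤

/-- The generating degree: the minimal `d ≥ -1` such that `V` is generated in degrees `≤ d`, and
`⊤` if there is none. -/
noncomputable def gd (ob : ℕ ≃ C) (V : Rep k C) : WithTop ℤ :=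
  sInf ((fun d : ℤ => (d : WithTop ℤ)) '' {d : ℤ | -1 ≤ d ∧ GeneratedInDegreesLE ob V d})

/-- The action on cokernels, `W(x) / im V(x) → W(y) / im V(y)`. -/
noncomputable def cokerAct {V W : Rep k C} (φ : V ⟶ W) {x y : C} (f : x ⟶ y) :
    (W.obj.obj x ⧸ LinearMap.range (Rep.comp φ x)) →ₗ[k]
      (W.obj.obj y ⧸ LinearMap.range (Rep.comp φ y)) :=
  Submodule.mapQ _ _ (W.act f) (by
    rintro _ ⟨v, rfl⟩
    exact ⟨V.act f v, congrArg (fun g => g.hom v) (φ.hom.naturality f)⟩)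

/-- The cokernel of a homomorphism of `C`-modules, `x ↦ W(x) / im (V(x) → W(x))`. -/
noncomputable def coker {V W : Rep k C} (φ : V ⟶ W) : Rep k C where
  obj :=
    { obj := fun x => ModuleCat.of k (W.obj.obj x ⧸ LinearMap.range (Rep.comp φ x))
      map := fun f => ModuleCat.ofHom (cokerAct φ f)
      map_id := fun x => by
        refine ModuleCat.hom_ext (Submodule.linearMap_qext _ (LinearMap.ext fun v => ?_))
        exact congrArg (Submodule.Quotient.mk (p := LinearMap.range (Rep.comp φ x)))
          (congrArg (fun g => g.hom v) (W.obj.map_id x))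
      map_comp := fun {x y z} f g => by
        refine ModuleCat.hom_ext (Submodule.linearMap_qext _ (LinearMap.ext fun v => ?_))
        exact congrArg (Submodule.Quotient.mk (p := LinearMap.range (Rep.comp φ z)))
          (congrArg (fun g => g.hom v) (W.obj.map_comp f g)) }
  property := by
    obtain ⟨hA, hL⟩ := W.property
    refine ⟨⟨fun {x y f g} => ?_⟩, ⟨fun {x y} f r => ?_⟩⟩
    · refine ModuleCat.hom_ext (Submodule.linearMap_qext _ (LinearMap.ext fun v => ?_))
      exact congrArg (Submodule.Quotient.mk (p := LinearMap.range (Rep.comp φ y)))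
        (congrArg (fun g => g.hom v) (hA.map_add (f := f) (g := g)))
    · refine ModuleCat.hom_ext (Submodule.linearMap_qext _ (LinearMap.ext fun v => ?_))
      exact congrArg (Submodule.Quotient.mk (p := LinearMap.range (Rep.comp φ y)))
        (congrArg (fun g => g.hom v) (hL.map_smul f r))

variable (k) in
/-- The representable `C`-module `M(s) = C(s, -)`. -/
def M (ob : ℕ ≃ C) (s : ℕ) : Rep k C where
  obj := (linearCoyoneda k C).obj (Opposite.op (ob s))
  property := ⟨inferInstance, ⟨fun f r =>
    ModuleCat.hom_ext (LinearMap.ext fun g => Linear.comp_smul _ _ _ g r f)⟩⟩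

/-- A self-embedding functor of degree 1: a faithful functor `ι : C ⥤ C` of `k`-linear categories
with `ι(s) = s + 1` for every `s`. -/
structure IsSelfEmbedding (ob : ℕ ≃ C) (ι : C ⥤ C) : Prop where
  faithful : ι.Faithful
  obj_eq : ∀ s : ℕ, ι.obj (ob s) = ob (s + 1)

variable (k) in
/-- The pull-back functor `ι^*` on `C`-modules: `V ↦ V ∘ ι`. -/
def shift (ι : C ⥤ C) [ι.Additive] [ι.Linear k] : Rep k C ⥤ Rep k C where
  obj V :=
    { obj := ι ⋙ V.obj
      property := by
        obtain ⟨_, _⟩ := V.property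
        exact ⟨inferInstance, inferInstance⟩ }
  map φ := ObjectProperty.homMk (Functor.whiskerLeft ι φ.hom)

/-- An endofunctor `S` of the category of `C`-modules is a shift functor if it is the pull-back
along some self-embedding functor of degree 1. -/
def IsShiftFunctor (ob : ℕ ≃ C) (S : Rep k C ⥤ Rep k C) : Prop :=
  ∃ (ι : C ⥤ C) (_ : ι.Additive) (_ : ι.Linear k), IsSelfEmbedding ob ι ∧ S = shift k ι

/-- A shift functor `S` is generic if there is a natural transformation `μ : Id → S` such that
each `M(s) → S M(s)` is injective with cokernel generated in degrees `≤ s - 1`. -/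
def IsGenericShiftFunctor (ob : ℕ ≃ C) (S : Rep k C ⥤ Rep k C) : Prop :=
  IsShiftFunctor ob S ∧
  ∃ μ : 𝟭 (Rep k C) ⟶ S, ∀ s : ℕ,
    (∀ x, Function.Injective (Rep.comp (μ.app (M k ob s)) x)) ∧
    GeneratedInDegreesLE ob (coker (μ.app (M k ob s))) ((s : ℤ) - 1)

end

end GenericShift

/-! Let DV be the cokernel of μ : V → SV. If V is generated in degrees ≤ d, then DV is generated in
degrees ≤ d - 1 (`generatedInDegreesLE_coker`), so one inducts on d, proving for pointwise
finite-dimensional V that every submodule W is generated in bounded degree and has eventually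
polynomial dimensions of degree at most d. For W ≤ V let sat W = μ⁻¹(SW) and let sh W be the image
of SW in DV. The exact sequence 0 → ker μ → sat W → SW → sh W → 0 reduces W in degree n + 1 to sat W
and to the submodule sh W of DV, already understood. The obstacle is that sat W may exceed W; but W
≤ sat W ≤ sat² W ≤ ⋯ stabilizes, because its shadows do (`saturation_stabilizes`). Descending from
the stable term gives bounded generation, and shows that dim sat W - dim W is eventually polynomial
of degree < d. So then is dim W_{n+1} - dim W_n, and summation raises the degree bound by one. -/

namespace GenericShift

/-! ### Eventually polynomial functions and their antidifferences. -/

section Polynomials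

open Polynomial Filter

/-- The function `f` agrees in large degrees with a polynomial of degree less than `d`. -/
def EventuallyPolynomial (d : ℕ) (f : ℕ → ℚ) : Prop :=
  ∃ Q ∈ degreeLT ℚ d, ∀ᶠ n : ℕ in atTop, f n = Q.eval (n : ℚ)

namespace EventuallyPolynomial

variable {d : ℕ} {f g : ℕ → ℚ}

theorem zero : EventuallyPolynomial d (fun _ => 0) :=
  ⟨0, Submodule.zero_mem _, by simp⟩

theorem add (hf : EventuallyPolynomial d f) (hg : EventuallyPolynomial d g) :
    EventuallyPolynomial d (fun n => f n + g n) := by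
  obtain ⟨P, hP, hfP⟩ := hf
  obtain ⟨Q, hQ, hgQ⟩ := hg
  refine ⟨P + Q, Submodule.add_mem _ hP hQ, ?_⟩
  filter_upwards [hfP, hgQ] with n h1 h2
  rw [h1, h2, eval_add]

theorem sub (hf : EventuallyPolynomial d f) (hg : EventuallyPolynomial d g) :
    EventuallyPolynomial d (fun n => f n - g n) := by
  obtain ⟨P, hP, hfP⟩ := hf
  obtain ⟨Q, hQ, hgQ⟩ := hg
  refine ⟨P - Q, Submodule.sub_mem _ hP hQ, ?_⟩
  filter_upwards [hfP, hgQ] with n h1 h2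
  rw [h1, h2, eval_sub]

theorem of_succ (hf : EventuallyPolynomial d (fun n => f (n + 1))) :
    EventuallyPolynomial d f := by
  obtain ⟨P, hP, hfP⟩ := hf
  refine ⟨P.comp (X - C 1), ?_, ?_⟩
  · rw [mem_degreeLT] at hP ⊢
    rcases eq_or_ne P 0 with rfl | h0
    · simp
    · refine lt_of_le_of_lt degree_le_natDegree ?_
      rw [natDegree_comp, natDegree_X_sub_C, mul_one]
      rwa [degree_eq_natDegree h0] at hP
  · obtain ⟨N, hN⟩ := eventually_atTop.mp hfP
    refine eventually_atTop.mpr ⟨N + 1, fun n hn => ?_⟩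
    obtain ⟨j, rfl⟩ : ∃ j, n = j + 1 := ⟨n - 1, by omega⟩
    refine (hN j (by omega)).trans ?_
    simp

end EventuallyPolynomial

theorem natDegree_bernoulli_le (n : ℕ) : (Polynomial.bernoulli n).natDegree ≤ n := by
  rw [Polynomial.bernoulli]
  exact natDegree_sum_le_of_forall_le _ _ fun i _ =>
    (natDegree_monomial_le _).trans (Nat.sub_le _ _)

/-- Every polynomial of degree `< d` is the difference of a polynomial of degree `< d + 1`. -/
theorem exists_antidifference {d : ℕ} {Q : ℚ[X]} (hQ : Q ∈ degreeLT ℚ d) :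
    ∃ R ∈ degreeLT ℚ (d + 1), ∀ x : ℚ, R.eval (x + 1) = R.eval x + Q.eval x := by
  -- Uses B_{i+1}(x + 1) - B_{i+1}(x) = (i + 1) x^i.
  refine ⟨∑ i ∈ Finset.range d, C (Q.coeff i / (i + 1)) * Polynomial.bernoulli (i + 1), ?_, ?_⟩
  · refine Submodule.sum_mem _ fun i hi => ?_
    rw [mem_degreeLT]
    refine lt_of_le_of_lt degree_le_natDegree ?_
    have h := (natDegree_C_mul_le (Q.coeff i / ((i : ℚ) + 1)) (Polynomial.bernoulli (i + 1))).trans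
      (natDegree_bernoulli_le (i + 1))
    have := Finset.mem_range.mp hi
    exact Nat.cast_lt.mpr (by omega)
  · intro x
    have hQx : Q.eval x = ∑ i ∈ Finset.range d, Q.coeff i * x ^ i := by
      rcases Nat.eq_zero_or_pos d with rfl | hd
      · have : Q = 0 := by simpa [mem_degreeLT] using hQ
        simp [this]
      · refine eval_eq_sum_range' ?_ x
        rw [mem_degreeLT] at hQ
        rcases eq_or_ne Q 0 with rfl | h0
        · simpa using hd
        · exact (natDegree_lt_iff_degree_lt h0).mpr hQ
    rw [hQx]
    simp only [eval_finsetSum, eval_mul, eval_C, ← Finset.sum_add_distrib]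
    refine Finset.sum_congr rfl fun i _ => ?_
    rw [add_comm x 1, bernoulli_eval_one_add]
    have : (i : ℚ) + 1 ≠ 0 := by positivity
    push_cast
    field_simp

theorem EventuallyPolynomial.of_difference {d : ℕ} {f : ℕ → ℚ}
    (hf : EventuallyPolynomial d (fun n => f (n + 1) - f n)) :
    EventuallyPolynomial (d + 1) f := by
  obtain ⟨Q, hQ, hfQ⟩ := hf
  obtain ⟨R, hR, hRQ⟩ := exists_antidifference hQ
  obtain ⟨N, hN⟩ := eventually_atTop.mp hfQ
  refine ⟨R + C (f N - R.eval (N : ℚ)), Submodule.add_mem _ hR ?_, ?_⟩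
  · rw [mem_degreeLT]
    exact lt_of_le_of_lt degree_C_le (by exact_mod_cast Nat.succ_pos d)
  · refine eventually_atTop.mpr ⟨N, fun n hn => ?_⟩
    induction n, hn using Nat.le_induction with
    | base => simp
    | succ n hn ih =>
      have h1 := hN n hn
      have h2 := hRQ n
      simp only [eval_add, eval_C] at ih ⊢
      push_cast
      linarith

end Polynomials

/-! ### Submodules, the Yoneda map, and bounded generation. -/

section Subrepresentations

variable {k : Type u} [CommRing k] {C : Type w} [Category.{v} C] [Preadditive C] [Linear k C]

theorem Rep.comp_act {V W : Rep k C} (φ : V ⟶ W) {x y : C} (f : x ⟶ y) (v : V.obj.obj x) :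
    Rep.comp φ y (V.act f v) = W.act f (Rep.comp φ x v) :=
  congrArg (fun g => g.hom v) (φ.hom.naturality f)

theorem Rep.act_comp (V : Rep k C) {x y z : C} (f : x ⟶ y) (g : y ⟶ z) (v : V.obj.obj x) :
    V.act (f ≫ g) v = V.act g (V.act f v) :=
  congrArg (fun h => h.hom v) (V.obj.map_comp f g)

theorem Rep.act_id (V : Rep k C) (x : C) (v : V.obj.obj x) : V.act (𝟙 x) v = v :=
  congrArg (fun h => h.hom v) (V.obj.map_id x)

/-- The action of morphisms on a fixed vector, as a linear map. -/
def Rep.orbit (V : Rep k C) {x : C} (v : V.obj.obj x) (y : C) : (x ⟶ y) →ₗ[k] V.obj.obj y where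
  toFun f := V.act f v
  map_add' f g := by
    obtain ⟨hA, _⟩ := V.property
    exact congrArg (fun h => h.hom v) (hA.map_add (f := f) (g := g))
  map_smul' r f := by
    obtain ⟨_, hL⟩ := V.property
    exact congrArg (fun h => h.hom v) (hL.map_smul f r)

/-- The homomorphism from a representable module given by a vector (Yoneda). -/
def Rep.ofVector (V : Rep k C) (ob : ℕ ≃ C) {s : ℕ} (v : V.obj.obj (ob s)) : M k ob s ⟶ V :=
  ObjectProperty.homMk
    { app := fun y => ModuleCat.ofHom (V.orbit v y)
      naturality := fun y _ g => ModuleCat.hom_ext (LinearMap.ext fun (f : ob s ⟶ y) =>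
        V.act_comp f g v) }

theorem Rep.comp_ofVector (V : Rep k C) (ob : ℕ ≃ C) {s : ℕ} (v : V.obj.obj (ob s)) {y : C}
    (f : ob s ⟶ y) : Rep.comp (V.ofVector ob v) y f = V.act f v :=
  rfl

/-- The projection onto the cokernel of a homomorphism. -/
noncomputable def cokerProj {V W : Rep k C} (φ : V ⟶ W) : W ⟶ coker φ :=
  ObjectProperty.homMk
    { app := fun x => ModuleCat.ofHom (Submodule.mkQ (LinearMap.range (Rep.comp φ x)))
      naturality := fun _ _ _ => rfl }

namespace SubRep

instance (V : Rep k C) : PartialOrder (SubRep V) :=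
  PartialOrder.lift SubRep.carrier fun U U' h => by cases U; cases U'; congr

theorem le_def {V : Rep k C} {U U' : SubRep V} : U ≤ U' ↔ ∀ x, U.carrier x ≤ U'.carrier x :=
  Iff.rfl

instance (V : Rep k C) : OrderTop (SubRep V) where
  top := ⟨fun _ => ⊤, fun _ _ _ => trivial⟩
  le_top _ _ _ _ := trivial

instance (V : Rep k C) : OrderBot (SubRep V) where
  bot := ⟨fun _ => ⊥, fun f v hv => by
    rw [Submodule.mem_bot] at hv ⊢
    rw [hv, map_zero]⟩
  bot_le _ _ := bot_le

theorem carrier_top (V : Rep k C) (x : C) : (⊤ : SubRep V).carrier x = ⊤ :=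
  rfl

theorem carrier_bot (V : Rep k C) (x : C) : (⊥ : SubRep V).carrier x = ⊥ :=
  rfl

/-- The intersection of two submodules. -/
def inter {V : Rep k C} (U U' : SubRep V) : SubRep V where
  carrier x := U.carrier x ⊓ U'.carrier x
  act_mem f _ hv := ⟨U.act_mem f hv.1, U'.act_mem f hv.2⟩

/-- The union of an increasing sequence of submodules. -/
def iUnion {V : Rep k C} (U : ℕ → SubRep V) : SubRep V where
  carrier x := ⨆ i, (U i).carrier x
  act_mem {x y} f v hv := by
    have : (⨆ i, (U i).carrier x) ≤ (⨆ i, (U i).carrier y).comap (V.act f) :=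
      iSup_le fun i v hv => Submodule.mem_iSup_of_mem i ((U i).act_mem f hv)
    exact this hv

/-- The preimage of a submodule. -/
def comap {V W : Rep k C} (φ : V ⟶ W) (U : SubRep W) : SubRep V where
  carrier x := (U.carrier x).comap (Rep.comp φ x)
  act_mem f v hv := by
    rw [Submodule.mem_comap] at hv ⊢
    rw [Rep.comp_act]
    exact U.act_mem f hv

/-- The image of a submodule. -/
def map {V W : Rep k C} (φ : V ⟶ W) (U : SubRep V) : SubRep W where
  carrier x := (U.carrier x).map (Rep.comp φ x)
  act_mem {x y} f w hw := by
    obtain ⟨v, hv, rfl⟩ := hw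
    exact ⟨V.act f v, U.act_mem f hv, Rep.comp_act φ f v⟩

/-- The pull-back of a submodule along a functor. -/
def pullback (ι : C ⥤ C) [ι.Additive] [ι.Linear k] {V : Rep k C} (U : SubRep V) :
    SubRep ((shift k ι).obj V) where
  carrier x := U.carrier (ι.obj x)
  act_mem f _ hv := U.act_mem (ι.map f) hv

/-- A submodule is generated by its components of degree at most `e`. -/
def GeneratedLE (ob : ℕ ≃ C) {V : Rep k C} (U : SubRep V) (e : ℕ) : Prop :=
  ∀ U' : SubRep V, (∀ x, ob.symm x ≤ e → U.carrier x ≤ U'.carrier x) → U ≤ U'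

/-- A submodule generated in degrees `≤ e` agrees with each of its submodules having the same
components of degree `≤ e`. -/
theorem generatedLE_of_le {ob : ℕ ≃ C} {V : Rep k C} {U : SubRep V} {e : ℕ}
    (h : ∀ U' ≤ U, (∀ x, ob.symm x ≤ e → U.carrier x ≤ U'.carrier x) → U ≤ U') :
    U.GeneratedLE ob e := fun U' hU' =>
  le_trans (h (U.inter U') (fun _ => inf_le_left) fun x hx => le_inf le_rfl (hU' x hx))
    fun _ => inf_le_right

end SubRep

/-- All submodules are generated in bounded degree. -/
def BoundedlyGenerated (ob : ℕ ≃ C) (V : Rep k C) : Prop :=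
  ∀ U : SubRep V, ∃ e, U.GeneratedLE ob e

end Subrepresentations

/-! ### Ascending chains of submodules over a field. -/

section Chains

variable {k : Type u} [Field k] {C : Type w} [Category.{v} C] [Preadditive C] [Linear k C]

theorem exists_forall_carrier_le {V : Rep k C} (hfin : ∀ x, Module.Finite k (V.obj.obj x))
    {U : ℕ → SubRep V} (hU : Monotone U) (x : C) :
    ∃ N, ∀ i, (U i).carrier x ≤ (U N).carrier x := by
  have := hfin x
  obtain ⟨N, hN⟩ := monotone_stabilizes_iff_noetherian.mpr
    (inferInstance : IsNoetherian k (V.obj.obj x))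
    ⟨fun i => (U i).carrier x, fun i j hij => hU hij x⟩
  refine ⟨N, fun i => ?_⟩
  rcases le_total N i with h | h
  · exact (hN i h).ge
  · exact hU h x

theorem exists_forall_carrier_le_of_degree_le (ob : ℕ ≃ C) {V : Rep k C}
    (hfin : ∀ x, Module.Finite k (V.obj.obj x)) {U : ℕ → SubRep V} (hU : Monotone U) (e : ℕ) :
    ∃ N, ∀ i x, ob.symm x ≤ e → (U i).carrier x ≤ (U N).carrier x := by
  choose N hN using fun n => exists_forall_carrier_le hfin hU (ob n)
  refine ⟨(Finset.range (e + 1)).sup N, fun i x hx => ?_⟩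
  obtain ⟨n, rfl⟩ := ob.surjective x
  rw [Equiv.symm_apply_apply] at hx
  exact (hN n i).trans (hU (Finset.le_sup (Finset.mem_range.mpr (by omega))) _)

/-- The union of the chain is generated in degrees ≤ e, and the finitely many finite-dimensional
components of degree ≤ e are exhausted at a finite stage. -/
theorem BoundedlyGenerated.exists_forall_le {ob : ℕ ≃ C} {V : Rep k C}
    (hV : BoundedlyGenerated ob V) (hfin : ∀ x, Module.Finite k (V.obj.obj x))
    {U : ℕ → SubRep V} (hU : Monotone U) : ∃ N, ∀ i, U i ≤ U N := by
  obtain ⟨e, he⟩ := hV (SubRep.iUnion U)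
  obtain ⟨N, hN⟩ := exists_forall_carrier_le_of_degree_le ob hfin hU e
  have h := he (U N) fun x hx => iSup_le fun i => hN i x hx
  exact ⟨N, fun i x => (le_iSup (fun i => (U i).carrier x) i).trans (h x)⟩

end Chains

/-! ### Degrees of objects: every object except `ob 0` lies in the image of ι. -/

section Degree

variable {C : Type w} [Category.{v} C] {ob : ℕ ≃ C} {ι : C ⥤ C}

theorem degree_obj (hι : ∀ s, ι.obj (ob s) = ob (s + 1)) (x : C) :
    ob.symm (ι.obj x) = ob.symm x + 1 := by
  obtain ⟨s, rfl⟩ := ob.surjective x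
  rw [hι, Equiv.symm_apply_apply, Equiv.symm_apply_apply]

/-- Induction on the degree of an object. -/
theorem degree_induction (hι : ∀ s, ι.obj (ob s) = ob (s + 1)) {p : C → Prop} (h0 : p (ob 0))
    (hs : ∀ x, p x → p (ι.obj x)) (x : C) : p x := by
  obtain ⟨s, rfl⟩ := ob.surjective x
  induction s with
  | zero => exact h0
  | succ s ih => exact hι s ▸ hs _ ih

end Degree

/-! ### Saturation, shadows, and the cokernel of V → SV. -/

section Shift

variable {k : Type u} [CommRing k] {C : Type w} [Category.{v} C] [Preadditive C] [Linear k C]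
  {ob : ℕ ≃ C} {ι : C ⥤ C} [ι.Additive] [ι.Linear k]

variable (μ : 𝟭 (Rep k C) ⟶ shift k ι)

/-- The component `V(x) → V(ι x)` of a natural transformation from the identity to a shift. -/
def shiftMap (V : Rep k C) (x : C) : V.obj.obj x →ₗ[k] V.obj.obj (ι.obj x) :=
  Rep.comp (μ.app V) x

theorem comp_shiftMap {V W : Rep k C} (φ : V ⟶ W) (x : C) (v : V.obj.obj x) :
    Rep.comp φ (ι.obj x) (shiftMap μ V x v) = shiftMap μ W x (Rep.comp φ x v) :=
  (congrArg (fun ψ => Rep.comp ψ x v) (μ.naturality φ)).symm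

/-- By naturality along the Yoneda map M(s) → V of v, μ sends v to its image under the morphism μ(𝟙)
: s ⟶ ι s, so every submodule is stable under μ. -/
theorem shiftMap_mem (ob : ℕ ≃ C) {V : Rep k C} (U : SubRep V) {x : C} {v : V.obj.obj x}
    (hv : v ∈ U.carrier x) : shiftMap μ V x v ∈ U.carrier (ι.obj x) := by
  obtain ⟨s, rfl⟩ := ob.surjective x
  have h := comp_shiftMap μ (V.ofVector ob v) (ob s) (𝟙 (ob s))
  rw [Rep.comp_ofVector, Rep.act_id] at h
  rw [← h]
  exact U.act_mem _ hv

namespace SubRep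

variable {V : Rep k C}

/-- The vectors of `V` that are mapped into the shift of a submodule. -/
def saturate (W : SubRep V) : SubRep V :=
  comap (μ.app V) (W.pullback ι)

/-- The image of the shift of a submodule in the cokernel of `V → SV`. -/
noncomputable def shadow (W : SubRep V) : SubRep (coker (μ.app V)) :=
  map (cokerProj (μ.app V)) (W.pullback ι)

theorem mem_saturate {W : SubRep V} {x : C} {v : V.obj.obj x} :
    v ∈ (W.saturate μ).carrier x ↔ shiftMap μ V x v ∈ W.carrier (ι.obj x) :=
  Iff.rfl

theorem shadow_mono {W W' : SubRep V} (h : W ≤ W') : W.shadow μ ≤ W'.shadow μ :=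
  fun x => Submodule.map_mono (h (ι.obj x))

theorem le_saturate (ob : ℕ ≃ C) (W : SubRep V) : W ≤ W.saturate μ :=
  fun _ _ hv => shiftMap_mem μ ob W hv

theorem exists_eq_add_shiftMap {W W' : SubRep V} {x : C}
    (h : (W.shadow μ).carrier x ≤ (W'.shadow μ).carrier x) {w : V.obj.obj (ι.obj x)}
    (hw : w ∈ W.carrier (ι.obj x)) :
    ∃ w' ∈ W'.carrier (ι.obj x), ∃ v, w = w' + shiftMap μ V x v := by
  obtain ⟨w', hw', heq⟩ := h (Submodule.mem_map_of_mem hw)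
  obtain ⟨v, hv⟩ := (Submodule.Quotient.eq (p := LinearMap.range (shiftMap μ V x))).mp heq.symm
  exact ⟨w', hw', v, by rw [hv]; exact (add_sub_cancel w' w).symm⟩

/-- The increasing sequence of the vectors of `V` that are mapped into the iterated shifts of
`W`. -/
def saturation (W : SubRep V) (i : ℕ) : SubRep V :=
  (saturate μ)^[i] W

theorem saturation_succ (W : SubRep V) (i : ℕ) :
    W.saturation μ (i + 1) = (W.saturation μ i).saturate μ :=
  Function.iterate_succ_apply' _ _ _

theorem saturation_mono (ob : ℕ ≃ C) (W : SubRep V) : Monotone (W.saturation μ) :=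
  monotone_nat_of_le_succ fun i => by
    rw [saturation_succ]
    exact le_saturate μ ob _

end SubRep

open SubRep

/-- If U ≤ W agrees with W in low degrees, then U also has the full saturation and shadow of W. An
element of SW is thus u + μ v with u in SU and v in sat W ≤ sat U, hence lies in SU. -/
theorem generatedLE_of_saturate (hι : ∀ s, ι.obj (ob s) = ob (s + 1)) {V : Rep k C}
    {W : SubRep V} {e e' : ℕ} (h : (W.saturate μ).GeneratedLE ob e)
    (h' : (W.shadow μ).GeneratedLE ob e') : W.GeneratedLE ob (max e e' + 1) := by
  refine generatedLE_of_le fun U hU hle => ?_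
  have hdeg : ∀ x, ob.symm x ≤ max e e' → W.carrier (ι.obj x) ≤ U.carrier (ι.obj x) :=
    fun x hx => hle _ (by rw [degree_obj hι]; omega)
  have hsat : W.saturate μ ≤ U.saturate μ := h _ fun x hx v hv =>
    hdeg x (hx.trans (le_max_left _ _)) hv
  have hsh : W.shadow μ ≤ U.shadow μ := h' _ fun x hx =>
    Submodule.map_mono (hdeg x (hx.trans (le_max_right _ _)))
  refine le_def.mpr (degree_induction hι ?_ fun x _ w hw => ?_)
  · exact hle _ (by rw [Equiv.symm_apply_apply]; omega)
  · obtain ⟨u, hu, v, rfl⟩ := exists_eq_add_shiftMap μ (hsh x) hw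
    exact add_mem hu (hsat x (((W.carrier _).add_mem_iff_right (hU _ hu)).mp hw))

/-- For saturated W the shadow suffices: in w = u + μ v the vector v lies in W one degree lower,
hence in U by induction on the degree. -/
theorem generatedLE_of_saturate_le (hι : ∀ s, ι.obj (ob s) = ob (s + 1)) {V : Rep k C}
    {W : SubRep V} {e : ℕ} (h : W.saturate μ ≤ W) (h' : (W.shadow μ).GeneratedLE ob e) :
    W.GeneratedLE ob (e + 1) := by
  refine generatedLE_of_le fun U hU hle => ?_
  have hsh : W.shadow μ ≤ U.shadow μ := h' _ fun x hx =>
    Submodule.map_mono (hle _ (by rw [degree_obj hι]; omega))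
  refine le_def.mpr (degree_induction hι ?_ fun x ih w hw => ?_)
  · exact hle _ (by rw [Equiv.symm_apply_apply]; omega)
  · obtain ⟨u, hu, v, rfl⟩ := exists_eq_add_shiftMap μ (hsh x) hw
    exact add_mem hu (shiftMap_mem μ ob U
      (ih (h x (((W.carrier _).add_mem_iff_right (hU _ hu)).mp hw))))

/-- If `V` is generated in degrees `≤ d`, the cokernel of `V → SV` is generated in degrees
`≤ d - 1`. -/
theorem generatedInDegreesLE_coker
    (hμ : ∀ s : ℕ, GeneratedInDegreesLE ob (coker (μ.app (M k ob s))) ((s : ℤ) - 1))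
    {V : Rep k C} {d : ℤ} (hV : GeneratedInDegreesLE ob V d) :
    GeneratedInDegreesLE ob (coker (μ.app V)) (d - 1) := by
  intro U hU
  let T : SubRep ((shift k ι).obj V) := comap (cokerProj (μ.app V)) U
  have hμT : ∀ x v, shiftMap μ V x v ∈ T.carrier x := fun x v => by
    have h : (LinearMap.range (shiftMap μ V x)).mkQ (shiftMap μ V x v) = 0 :=
      (Submodule.Quotient.mk_eq_zero _).mpr ⟨v, rfl⟩
    exact (congrArg (· ∈ U.carrier x) h).mpr (zero_mem _)
  -- T need only be all of SV. The largest submodule G of V whose elements every morphism into an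
  -- object ι x sends into T is tested on the generating degrees of V.
  let t (x : C) : Submodule k (V.obj.obj (ι.obj x)) := T.carrier x
  let G : SubRep V :=
    { carrier := fun y => ⨅ (x : C) (f : y ⟶ ι.obj x), (t x).comap (V.act f)
      act_mem := fun {y z} g v hv => by
        simp only [Submodule.mem_iInf, Submodule.mem_comap] at hv ⊢
        intro x f
        rw [← V.act_comp]
        exact hv x _ }
  have hG : ∀ x, G.carrier x = ⊤ := hV G fun r hr => by
    refine Submodule.eq_top_iff'.mpr fun v => ?_
    simp only [G, Submodule.mem_iInf, Submodule.mem_comap]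
    intro x f
    -- T' contains the image of μ and maps onto the cokernel for M(r), which is generated in degrees
    -- where T is everything; so T' = SM(r).
    let T' : SubRep ((shift k ι).obj (M k ob r)) := comap ((shift k ι).map (V.ofVector ob v)) T
    have htop := hμ r (map (cokerProj (μ.app (M k ob r))) T') fun s hs => by
      refine Submodule.eq_top_iff'.mpr fun q => ?_
      obtain ⟨g, rfl⟩ := Submodule.mkQ_surjective _ q
      refine Submodule.mem_map_of_mem (Submodule.mem_comap.mpr ?_)
      exact (congrArg (_ ∈ ·) (hU s (by omega))).mpr trivial
    obtain ⟨f', hf', heq⟩ := (congrArg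
      ((LinearMap.range (shiftMap μ (M k ob r) x)).mkQ f ∈ ·) (htop x)).mpr trivial
    obtain ⟨g, hg⟩ :=
      (Submodule.Quotient.eq (p := LinearMap.range (shiftMap μ (M k ob r) x))).mp heq.symm
    have hμT' : shiftMap μ (M k ob r) x g ∈ T'.carrier x :=
      (congrArg (· ∈ T.carrier x) (comp_shiftMap μ (V.ofVector ob v) x g)).mpr (hμT x _)
    rw [hg] at hμT'
    exact (Submodule.sub_mem_iff_left (T'.carrier x) hf').mp hμT'
  refine fun x => Submodule.eq_top_iff'.mpr fun q => ?_
  obtain ⟨v, rfl⟩ := Submodule.mkQ_surjective (LinearMap.range (shiftMap μ V x)) q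
  have hv : v ∈ G.carrier (ι.obj x) := (congrArg (v ∈ ·) (hG (ι.obj x))).mpr trivial
  simp only [G, Submodule.mem_iInf, Submodule.mem_comap] at hv
  have h := hv x (𝟙 _)
  rw [V.act_id] at h
  exact h

end Shift

/-! ### Stabilization of saturations and transfer of bounded generation. -/

section Stabilization

variable {k : Type u} [Field k] {C : Type w} [Category.{v} C] [Preadditive C] [Linear k C]
  {ob : ℕ ≃ C} {ι : C ⥤ C} [ι.Additive] [ι.Linear k] (μ : 𝟭 (Rep k C) ⟶ shift k ι)

open SubRep

theorem finite_coker {V : Rep k C} (hfin : ∀ x, Module.Finite k (V.obj.obj x)) (x : C) :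
    Module.Finite k ((coker (μ.app V)).obj.obj x) :=
  have := hfin (ι.obj x)
  inferInstanceAs (Module.Finite k (V.obj.obj (ι.obj x) ⧸ LinearMap.range (shiftMap μ V x)))

theorem saturation_stabilizes (hι : ∀ s, ι.obj (ob s) = ob (s + 1)) {V : Rep k C}
    (hfin : ∀ x, Module.Finite k (V.obj.obj x))
    (hD : BoundedlyGenerated ob (coker (μ.app V))) (W : SubRep V) :
    ∃ N, (W.saturation μ N).saturate μ ≤ W.saturation μ N := by
  have hmono := W.saturation_mono μ ob
  obtain ⟨N, hN⟩ := hD.exists_forall_le (finite_coker μ hfin)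
    (U := fun i => (W.saturation μ i).shadow μ) fun i j hij => shadow_mono μ (hmono hij)
  obtain ⟨J, hJ⟩ := exists_forall_carrier_le hfin hmono (ob 0)
  -- The bound on i is uniform in x: passing from x to ι x uses the claim at x for i + 1, which is
  -- still past the threshold.
  have key : ∀ x, ∀ i, max N J ≤ i →
      (W.saturation μ (i + 1)).carrier x ≤ (W.saturation μ i).carrier x := by
    refine degree_induction hι (fun i hi => ?_) fun x ih i hi w hw => ?_
    · exact (hJ _).trans (hmono ((le_max_right _ _).trans hi) _)
    · have hle : ((W.saturation μ (i + 1)).shadow μ) ≤ (W.saturation μ i).shadow μ :=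
        (hN _).trans (shadow_mono μ (hmono ((le_max_left _ _).trans hi)))
      obtain ⟨u, hu, v, rfl⟩ := exists_eq_add_shiftMap μ (hle x) hw
      refine add_mem hu ?_
      have hv := (Submodule.add_mem_iff_right _ (hmono (Nat.le_succ i) _ hu)).mp hw
      rw [← mem_saturate, ← saturation_succ] at hv ⊢
      exact ih (i + 1) (by omega) hv
  refine ⟨max N J, fun x => ?_⟩
  rw [← saturation_succ]
  exact key x _ le_rfl

theorem boundedlyGenerated_of_coker (hι : ∀ s, ι.obj (ob s) = ob (s + 1)) {V : Rep k C}
    (hfin : ∀ x, Module.Finite k (V.obj.obj x))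
    (hD : BoundedlyGenerated ob (coker (μ.app V))) : BoundedlyGenerated ob V := by
  intro W
  obtain ⟨N, hN⟩ := saturation_stabilizes μ hι hfin hD W
  have hW : ∃ e, (W.saturation μ N).GeneratedLE ob e := by
    obtain ⟨e, he⟩ := hD ((W.saturation μ N).shadow μ)
    exact ⟨_, generatedLE_of_saturate_le μ hι hN he⟩
  clear hN
  -- Descend from the saturated stage back to W.
  induction N with
  | zero => exact hW
  | succ N ih =>
    obtain ⟨e, he⟩ := hW
    obtain ⟨e', he'⟩ := hD ((W.saturation μ N).shadow μ)
    rw [saturation_succ] at he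
    exact ih ⟨_, generatedLE_of_saturate μ hι he he'⟩

theorem finrank_add_finrank_ker_eq {A B : Type*} [AddCommGroup A] [Module k A] [AddCommGroup B]
    [Module k B] [Module.Finite k A] (f : A →ₗ[k] B) (U : Submodule k A) :
    Module.finrank k (U.map f) + Module.finrank k ↥(U ⊓ LinearMap.ker f) =
      Module.finrank k U := by
  rw [← LinearMap.finrank_range_add_finrank_ker (f.domRestrict U), LinearMap.range_domRestrict,
    LinearMap.ker_domRestrict, ← (Submodule.comap_equiv_self_of_inj_of_le (f := U.subtype)
      (p := U ⊓ LinearMap.ker f) U.injective_subtype (by simp)).finrank_eq]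
  rw [Submodule.comap_inf, Submodule.comap_subtype_self, top_inf_eq]

theorem finrank_eq_of_exact_sequence {A B : Type*} [AddCommGroup A] [Module k A]
    [AddCommGroup B] [Module k B] [Module.Finite k A] [Module.Finite k B] (f : A →ₗ[k] B)
    (U : Submodule k B) :
    Module.finrank k U + Module.finrank k (LinearMap.ker f) =
      Module.finrank k (U.comap f) + Module.finrank k (U.map (LinearMap.range f).mkQ) := by
  have h1 := finrank_add_finrank_ker_eq f (U.comap f)
  have h2 := finrank_add_finrank_ker_eq (LinearMap.range f).mkQ U
  rw [Submodule.map_comap_eq, inf_eq_right.mpr (LinearMap.ker_le_comap f)] at h1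
  rw [Submodule.ker_mkQ, inf_comm] at h2
  omega

end Stabilization

/-! ### Dimension functions and the induction on the generating degree. -/

section Growth

variable {k : Type u} [Field k] {C : Type w} [Category.{v} C] [Preadditive C] [Linear k C]

open SubRep

/-- The dimension function of a submodule. -/
noncomputable def SubRep.dim (ob : ℕ ≃ C) {V : Rep k C} (U : SubRep V) (n : ℕ) : ℚ :=
  Module.finrank k (U.carrier (ob n))

variable {ob : ℕ ≃ C} {ι : C ⥤ C} [ι.Additive] [ι.Linear k] (μ : 𝟭 (Rep k C) ⟶ shift k ι)

theorem dim_bot (V : Rep k C) (n : ℕ) : (⊥ : SubRep V).dim ob n = 0 := by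
  rw [SubRep.dim, carrier_bot, finrank_bot, Nat.cast_zero]

theorem dim_succ (hι : ∀ s, ι.obj (ob s) = ob (s + 1)) {V : Rep k C}
    (hfin : ∀ x, Module.Finite k (V.obj.obj x)) (W : SubRep V) (n : ℕ) :
    W.dim ob (n + 1) =
      (W.saturate μ).dim ob n + (W.shadow μ).dim ob n - ((⊥ : SubRep V).saturate μ).dim ob n := by
  have := hfin (ob n)
  have := hfin (ι.obj (ob n))
  have h : Module.finrank k (W.carrier (ι.obj (ob n))) +
        Module.finrank k (((⊥ : SubRep V).saturate μ).carrier (ob n)) =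
      Module.finrank k ((W.saturate μ).carrier (ob n)) +
        Module.finrank k ((W.shadow μ).carrier (ob n)) :=
    finrank_eq_of_exact_sequence (shiftMap μ V (ob n)) (W.carrier (ι.obj (ob n)))
  rw [hι] at h
  rw [eq_sub_iff_add_eq]
  unfold SubRep.dim
  exact_mod_cast h

/-- The difference vanishes at the stable stage. For U = satⁱ W, its value for U at n + 1 is its
value for sat U at n plus a difference of shadow dimensions (the ker μ terms cancel), so it descends
to W. -/
theorem eventuallyPolynomial_saturate_sub (hι : ∀ s, ι.obj (ob s) = ob (s + 1)) {V : Rep k C}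
    (hfin : ∀ x, Module.Finite k (V.obj.obj x))
    (hD : BoundedlyGenerated ob (coker (μ.app V))) {d : ℕ}
    (hdim : ∀ U : SubRep (coker (μ.app V)), EventuallyPolynomial d (U.dim ob)) (W : SubRep V) :
    EventuallyPolynomial d (fun n => (W.saturate μ).dim ob n - W.dim ob n) := by
  obtain ⟨N, hN⟩ := saturation_stabilizes μ hι hfin hD W
  have hW : EventuallyPolynomial d (fun n =>
      ((W.saturation μ N).saturate μ).dim ob n - (W.saturation μ N).dim ob n) := by
    rw [le_antisymm hN (le_saturate μ ob _)]
    simpa using EventuallyPolynomial.zero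
  clear hN
  induction N with
  | zero => exact hW
  | succ N ih =>
    refine ih (EventuallyPolynomial.of_succ ?_)
    rw [saturation_succ] at hW
    convert (hW.add (hdim (((W.saturation μ N).saturate μ).shadow μ))).sub
      (hdim ((W.saturation μ N).shadow μ)) using 2 with n
    rw [dim_succ μ hι hfin, dim_succ μ hι hfin (W.saturation μ N)]
    ring

theorem eventuallyPolynomial_dim (hι : ∀ s, ι.obj (ob s) = ob (s + 1)) {V : Rep k C}
    (hfin : ∀ x, Module.Finite k (V.obj.obj x))
    (hD : BoundedlyGenerated ob (coker (μ.app V))) {d : ℕ}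
    (hdim : ∀ U : SubRep (coker (μ.app V)), EventuallyPolynomial d (U.dim ob)) (W : SubRep V) :
    EventuallyPolynomial (d + 1) (W.dim ob) := by
  -- sat ⊥ = ker μ, so this controls the kernel term of `dim_succ`.
  have h0 := eventuallyPolynomial_saturate_sub μ hι hfin hD hdim ⊥
  simp only [dim_bot, sub_zero] at h0
  refine EventuallyPolynomial.of_difference ?_
  convert ((eventuallyPolynomial_saturate_sub μ hι hfin hD hdim W).add
    (hdim (W.shadow μ))).sub h0 using 2 with n
  rw [dim_succ μ hι hfin]
  ring

/-- The two conclusions are proved together: bounded generation for submodules of DV is what makes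
saturations in V stabilize. Here d is the generation bound plus one, so d = 0 is V = 0. -/
theorem boundedlyGenerated_and_eventuallyPolynomial
    (hμ : ∀ s : ℕ, GeneratedInDegreesLE ob (coker (μ.app (M k ob s))) ((s : ℤ) - 1))
    (hι : ∀ s, ι.obj (ob s) = ob (s + 1)) (d : ℕ) :
    ∀ V : Rep k C, (∀ x, Module.Finite k (V.obj.obj x)) →
      GeneratedInDegreesLE ob V ((d : ℤ) - 1) →
      BoundedlyGenerated ob V ∧ ∀ W : SubRep V, EventuallyPolynomial d (W.dim ob) := by
  induction d with
  | zero =>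
    intro V _ hV
    have hbot : ∀ W : SubRep V, W = ⊥ := fun W => by
      refine le_antisymm (fun x v _ => ?_) bot_le
      rw [hV ⊥ (fun r hr => by push_cast at hr; omega) x]
      trivial
    refine ⟨fun W => ⟨0, fun U _ => (hbot W).trans_le bot_le⟩, fun W => ?_⟩
    rw [hbot W, funext (dim_bot V)]
    exact EventuallyPolynomial.zero
  | succ d ih =>
    intro V hfin hV
    obtain ⟨hD, hdim⟩ := ih (coker (μ.app V)) (finite_coker μ hfin)
      (generatedInDegreesLE_coker μ hμ (by rwa [Nat.cast_succ, add_sub_cancel_right] at hV))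
    exact ⟨boundedlyGenerated_of_coker μ hι hfin hD,
      eventuallyPolynomial_dim μ hι hfin hD hdim⟩

end Growth

/-! ### Finite generation: finite-dimensional components and finite generating degree. -/

section FinitelyGenerated

variable {k : Type u} [CommRing k] {C : Type w} [Category.{v} C] [Preadditive C] [Linear k C]
  {ob : ℕ ≃ C}

theorem FinitelyGenerated.finite {V : Rep k C} (hV : FinitelyGenerated V)
    (hC : ∀ x y : C, Module.Finite k (x ⟶ y)) (y : C) : Module.Finite k (V.obj.obj y) := by
  obtain ⟨X, hX, hgen⟩ := hV
  let U : SubRep V :=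
    { carrier := fun y => ⨆ p : X, LinearMap.range (V.orbit p.1.2 y)
      act_mem := fun {y z} f v hv => by
        have hle : (⨆ p : X, LinearMap.range (V.orbit p.1.2 y)) ≤
            (⨆ p : X, LinearMap.range (V.orbit p.1.2 z)).comap (V.act f) := by
          refine iSup_le fun p => ?_
          rintro _ ⟨g, rfl⟩
          exact Submodule.mem_iSup_of_mem p ⟨g ≫ f, V.act_comp g f _⟩
        exact hle hv }
  have hU := hgen U (fun p hp => Submodule.mem_iSup_of_mem ⟨p, hp⟩ ⟨𝟙 _, V.act_id _ _⟩) y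
  have := hX.to_subtype
  rw [Module.finite_def, ← hU]
  exact Submodule.fg_iSup _ fun p => by
    rw [LinearMap.range_eq_map]
    exact (hC p.1.1 y).fg_top.map _

theorem FinitelyGenerated.exists_generatedInDegreesLE {V : Rep k C} (hV : FinitelyGenerated V) :
    ∃ e : ℕ, GeneratedInDegreesLE ob V e := by
  obtain ⟨X, hX, hgen⟩ := hV
  refine ⟨hX.toFinset.sup fun p => ob.symm p.1, fun U hU => hgen U fun p hp => ?_⟩
  have h := hU (ob.symm p.1) (Int.ofNat_le.mpr
    (Finset.le_sup (f := fun p : Σ x : C, V.obj.obj x => ob.symm p.1) (hX.mem_toFinset.mpr hp)))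
  rw [Equiv.apply_symm_apply] at h
  rw [h]
  trivial

/-- The generating degree of a finitely generated module is attained. -/
theorem FinitelyGenerated.exists_gd_eq {V : Rep k C} (hV : FinitelyGenerated V) :
    ∃ d : ℕ, gd ob V = (((d : ℤ) - 1 : ℤ) : WithTop ℤ) ∧
      GeneratedInDegreesLE ob V ((d : ℤ) - 1) := by
  obtain ⟨e, he⟩ := hV.exists_generatedInDegreesLE (ob := ob)
  have hne : {d : ℤ | -1 ≤ d ∧ GeneratedInDegreesLE ob V d}.Nonempty := ⟨e, by omega, he⟩
  have hbdd : BddBelow {d : ℤ | -1 ≤ d ∧ GeneratedInDegreesLE ob V d} := ⟨-1, fun _ h => h.1⟩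
  obtain ⟨h1, h2⟩ := Int.csInf_mem hne hbdd
  refine ⟨(sInf {d : ℤ | -1 ≤ d ∧ GeneratedInDegreesLE ob V d} + 1).toNat, ?_⟩
  rw [Int.toNat_of_nonneg (by omega), add_sub_cancel_right]
  exact ⟨(WithTop.coe_sInf' hne hbdd).symm, h2⟩

end FinitelyGenerated

end GenericShift

theorem corollary1p4 {k : Type u} [Field k] {C : Type w} [Category.{v} C]
    [Preadditive C] [Linear k C] (ob : ℕ ≃ C)
    (hC : GenericShift.IsLocallyFiniteDirected k ob)
    (S : GenericShift.Rep k C ⥤ GenericShift.Rep k C)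
    (hS : GenericShift.IsGenericShiftFunctor ob S)
    (hSM : ∀ s : ℕ, GenericShift.FinitelyPresented (S.obj (GenericShift.M k ob s)))
    (V : GenericShift.Rep k C) (hV : GenericShift.FinitelyGenerated V) :
    (∀ n : ℕ, Module.Finite k (V.obj.obj (ob n))) ∧
    ∃ Q : Polynomial ℚ,
      (Q ≠ 0 → ((Q.natDegree : ℤ) : WithTop ℤ) ≤ GenericShift.gd ob V) ∧
      ∀ᶠ n : ℕ in Filter.atTop,
        (Module.finrank k (V.obj.obj (ob n)) : ℚ) = Q.eval (n : ℚ) := by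
  have hhom : ∀ x y : C, Module.Finite k (x ⟶ y) := fun x y => by
    obtain ⟨r, rfl⟩ := ob.surjective x
    obtain ⟨s, rfl⟩ := ob.surjective y
    exact hC.locallyFinite r s
  have hfin := hV.finite hhom
  refine ⟨fun n => hfin _, ?_⟩
  obtain ⟨⟨ι, _, _, hι, rfl⟩, μ, hμ⟩ := hS
  obtain ⟨d, hd, hgen⟩ := hV.exists_gd_eq (ob := ob)
  obtain ⟨Q, hQ, hdim⟩ := (GenericShift.boundedlyGenerated_and_eventuallyPolynomial μ
    (fun s => (hμ s).2) hι.obj_eq d V hfin hgen).2 ⊤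
  refine ⟨Q, fun h0 => ?_, ?_⟩
  · rw [Polynomial.mem_degreeLT, ← Polynomial.natDegree_lt_iff_degree_lt h0] at hQ
    rw [hd]
    exact WithTop.coe_le_coe.mpr (by omega)
  · filter_upwards [hdim] with n hn
    rw [← hn, GenericShift.SubRep.dim, GenericShift.SubRep.carrier_top, finrank_top]
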